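/- Let $p$ be a prime, $t\ge 1$ an integer, $q=p^t$, and let $n,d$ be integers with $1\le d\le n-1$. Let $PG_d(n,q)$ be the incidence structure (design) whose points are the points of the projective geometry $PG(n,q)$ over $GF(q)$ and whose blocks are its $d$-dimensional projective subspaces, and let $AG_d(n,q)$ be the design whose points are the points of the affine geometry $AG(n,q)$ over $GF(q)$ and whose blocks are its $d$-dimensional affine subspaces. For a design $\mathcal D$ with point set $X$ and blocks $B_1,\dots,B_b$, and a block $B$ of $\mathcal D$, the residual design $\mathcal D_B$ has point set $X\setminus B$ and blocks $B_j\setminus B$, one for every block $B_j$ of $\mathcal D$ other than $B$. Write $\operatorname{rank}_p\mathcal D$ for the rank over $GF(p)$ of the point-by-block $(0,1)$-incidence matrix of $\mathcal D$. Then every residual design of $PG_d(n,q)$ and of $AG_d(n,q)$ is linearly embeddable over $GF(p)$, that is, $$\operatorname{rank}_p \mathcal D=\operatorname{rank}_p \mathcal D_B+1$$ for $\mathcal D=PG_d(n,q)$ and every block $B$ of $\mathcal D$, and likewise for $\mathcal D=AG_d(n,q)$ and every block $B$ of $\mathcal D$. -/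

import Mathlib

/-- A combinatorial design (incidence structure): a finite set `X` of points together with a finite
collection `(block j)`, `j ∈ J`, of subsets of `X`, the blocks. -/
structure Design (X J : Type*) [Finite X] [Finite J] where
  /-- the set of points of the block with label `j` -/
  block : J → Set X

namespace Design

variable {X J : Type*} [Finite X] [Finite J]

open Classical in
/-- The point-by-block incidence matrix, with entries `0` and `1` in the ring `R`. -/
noncomputable def incidenceMatrix (D : Design X J) (R : Type*) [Zero R] [One R] : Matrix X J R :=
  Matrix.of fun x j => if x ∈ D.block j then 1 else 0

/-- The `p`-rank of a design: the rank of its incidence matrix over `GF(p) = ZMod p`. -/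
noncomputable def pRank (D : Design X J) (p : ℕ) : ℕ :=
  letI : Fintype J := Fintype.ofFinite J
  (D.incidenceMatrix (ZMod p)).rank

/-- The residual design with respect to the block `B`: its points are the points outside `B`, its
blocks are the sets `B_j \ B`, one for each block `B_j` other than `B`. -/
def residual (D : Design X J) (B : J) : Design {x : X // x ∉ D.block B} {j : J // j ≠ B} where
  block j := {x | (x : X) ∈ D.block j}

/-- The residual design of `D` with respect to `B` is linearly embeddable over `GF(p)`:
the `p`-ranks of `D` and of the residual design differ by one. -/
def ResidualLinearlyEmbeddable (D : Design X J) (B : J) (p : ℕ) : Prop :=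
  D.pRank p = (D.residual B).pRank p + 1

end Design

/-- The `d`-dimensional subspaces of the projective geometry `PG(n, K)`, i.e. those given by the
`(d + 1)`-dimensional linear subspaces of `K ^ (n + 1)`. -/
abbrev ProjFlat (K : Type*) [Field K] (n d : ℕ) : Type _ :=
  {U : Projectivization.Subspace K (Fin (n + 1) → K) //
    Module.finrank K (Projectivization.Subspace.submodule U) = d + 1}

/-- The `d`-dimensional (nonempty) affine subspaces of the affine geometry `AG(n, K)`. -/
abbrev AffFlat (K : Type*) [Field K] (n d : ℕ) : Type _ :=
  {F : AffineSubspace K (Fin n → K) //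
    (F : Set (Fin n → K)).Nonempty ∧ Module.finrank K F.direction = d}

instance projFlat_finite (K : Type*) [Field K] [Finite K] (n d : ℕ) : Finite (ProjFlat K n d) :=
  Finite.of_injective
    (fun U : ProjFlat K n d => (U.1 : Set (Projectivization K (Fin (n + 1) → K))))
    fun _ _ h => Subtype.ext (SetLike.coe_injective h)

instance affFlat_finite (K : Type*) [Field K] [Finite K] (n d : ℕ) : Finite (AffFlat K n d) :=
  Finite.of_injective (fun F : AffFlat K n d => (F.1 : Set (Fin n → K)))
    fun _ _ h => Subtype.ext (SetLike.coe_injective h)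

/-- The projective geometry design `PG_d(n, K)`: the points are those of `PG(n, K)`, the blocks are
its `d`-dimensional subspaces. -/
def projDesign (K : Type*) [Field K] [Finite K] (n d : ℕ) :
    Design (Projectivization K (Fin (n + 1) → K)) (ProjFlat K n d) where
  block U := (U.1 : Set (Projectivization K (Fin (n + 1) → K)))

/-- The affine geometry design `AG_d(n, K)`: the points are those of `AG(n, K)`, the blocks are
its `d`-dimensional affine subspaces. -/
def affDesign (K : Type*) [Field K] [Finite K] (n d : ℕ) :
    Design (Fin n → K) (AffFlat K n d) where
  block F := (F.1 : Set (Fin n → K))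

/-! Deleting the points of `B` maps the code `C` spanned by the blocks onto the residual code, so
the rank drops by the dimension of the subcode of `C` supported on `B`. This subcode contains the
indicator of `B`; the claim is that it contains only its multiples. If `S` and `T` cut `x` and `y`
out of `B` and meet all blocks equally mod `p`, then `1_S - 1_T` is orthogonal to `C`, so a codeword
supported on `B` agrees at `x` and `y`. In both geometries `S` and `T` are the flats through `x` and
`y` determined by one linear complement `N` of `B`. -/

open Module in
/-- A codeword of a design supported on a block `B` is constant on `B`, hence the residual design
is linearly embeddable, as soon as any two points of `B` are cut out of `B` by point sets that meet
every block in the same number of points modulo `p`. -/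
theorem Design.residualLinearlyEmbeddable_of_inter_modEq {X J : Type*} [Finite X] [Finite J]
    (D : Design X J) (B : J) (p : ℕ) (hp : p.Prime) (hB : (D.block B).Nonempty)
    (h : ∀ x ∈ D.block B, ∀ y ∈ D.block B, ∃ S T : Set X,
      D.block B ∩ S = {x} ∧ D.block B ∩ T = {y} ∧
        ∀ j, (D.block j ∩ S).ncard ≡ (D.block j ∩ T).ncard [MOD p]) :
    D.ResidualLinearlyEmbeddable B p := by
  classical
  have : Fact p.Prime := ⟨hp⟩
  let _ : Fintype X := Fintype.ofFinite X
  let _ : Fintype J := Fintype.ofFinite J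
  unfold Design.ResidualLinearlyEmbeddable Design.pRank
  simp only [Matrix.rank_eq_finrank_span_cols]
  set C := Submodule.span (ZMod p) (Set.range (D.incidenceMatrix (ZMod p)).col) with hC
  let r : (X → ZMod p) →ₗ[ZMod p] ({x : X // x ∉ D.block B} → ZMod p) :=
    LinearMap.funLeft _ _ Subtype.val
  have hmap : Submodule.span (ZMod p)
      (Set.range ((D.residual B).incidenceMatrix (ZMod p)).col) = C.map r := by
    rw [hC, Submodule.map_span]
    refine le_antisymm (Submodule.span_mono ?_) (Submodule.span_le.2 ?_)
    · rintro _ ⟨j, rfl⟩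
      exact ⟨_, ⟨j.1, rfl⟩, rfl⟩
    · rintro _ ⟨_, ⟨j, rfl⟩, rfl⟩
      -- The residual design has no block for `B`, but the column of `B` restricts to zero anyway.
      by_cases hj : j = B
      · have h0 : r ((D.incidenceMatrix (ZMod p)).col j) = 0 := by
          subst hj
          ext x
          exact if_neg x.2
        rw [h0]
        exact Submodule.zero_mem _
      · exact Submodule.subset_span ⟨⟨j, hj⟩, rfl⟩
  obtain ⟨x₀, hx₀⟩ := hB
  set b := (D.incidenceMatrix (ZMod p)).col B with hb
  have hbx : ∀ x, b x = if x ∈ D.block B then 1 else 0 := fun x => rfl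
  have hbC : b ∈ C := Submodule.subset_span ⟨B, rfl⟩
  have hb0 : b ≠ 0 := fun h0 => by
    have := congrFun h0 x₀
    simp [hbx, hx₀] at this
  have hker : C ⊓ LinearMap.ker r = Submodule.span (ZMod p) {b} := by
    refine le_antisymm ?_ ?_
    · rintro c ⟨hcC, hcr⟩
      have hsupp : ∀ x, x ∉ D.block B → c x = 0 := fun x hx => congrFun hcr ⟨x, hx⟩
      have hconst : ∀ y ∈ D.block B, c y = c x₀ := by
        intro y hy
        obtain ⟨S, T, hS, hT, hST⟩ := h y hy x₀ hx₀
        -- `1_S - 1_T` lies in the dual code; it suffices to test it on blocks.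
        have hdual : ∀ c ∈ C, ∑ z with z ∈ S, c z = ∑ z with z ∈ T, c z := by
          intro c hc
          induction hc using Submodule.span_induction with
          | mem c hc =>
            obtain ⟨j, rfl⟩ := hc
            have hcount : ∀ U : Set X, ∑ z with z ∈ U, (D.incidenceMatrix (ZMod p)).col j z
                = ((D.block j ∩ U).ncard : ZMod p) := by
              intro U
              change ∑ z with z ∈ U, (if z ∈ D.block j then (1 : ZMod p) else 0) = _
              rw [Finset.sum_boole, Set.ncard_eq_toFinset_card']
              congr 2
              ext z
              simp [and_comm]
            rw [hcount, hcount]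
            exact (ZMod.natCast_eq_natCast_iff _ _ _).2 (hST j)
          | zero => simp
          | add u v _ _ hu hv => simp [Finset.sum_add_distrib, hu, hv]
          | smul a u _ hu => simp [← Finset.mul_sum, hu]
        have hpick : ∀ U : Set X, ∀ z, D.block B ∩ U = {z} → ∑ w with w ∈ U, c w = c z := by
          intro U z hU
          have hz : z ∈ D.block B ∩ U := hU ▸ rfl
          refine Finset.sum_eq_single_of_mem z (by simpa using hz.2) ?_
          intro w hw hwz
          refine hsupp w fun hwB => hwz ?_
          have : w ∈ D.block B ∩ U := ⟨hwB, by simpa using hw⟩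
          rwa [hU] at this
        rw [← hpick S y hS, ← hpick T x₀ hT]
        exact hdual c hcC
      refine Submodule.mem_span_singleton.2 ⟨c x₀, ?_⟩
      ext x
      by_cases hx : x ∈ D.block B
      · simp [hbx, hx, hconst x hx]
      · simp [hbx, hx, hsupp x hx]
    · rw [Submodule.span_singleton_le_iff_mem]
      refine ⟨hbC, ?_⟩
      ext x
      exact if_neg x.2
  have hrn := (r.domRestrict C).finrank_range_add_finrank_ker
  have hk : finrank (ZMod p) (LinearMap.ker (r.domRestrict C)) = 1 := by
    rw [LinearMap.ker_domRestrict, ← finrank_span_singleton (K := ZMod p) hb0, ← hker,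
      ← Submodule.map_comap_subtype]
    exact (Submodule.finrank_map_subtype_eq _ _).symm
  rw [LinearMap.range_domRestrict, hk] at hrn
  rw [← hrn, ← hmap]

open Module in
/-- A nonempty finite projective space of order divisible by `p` has `1` modulo `p` points. -/
theorem Submodule.ncard_projectivization_modEq_one {K V : Type*} [Field K] [Finite K]
    [AddCommGroup V] [Module K V] [FiniteDimensional K V] {p : ℕ} (hp : p ∣ Nat.card K)
    (N : Submodule K V) (hN : N ≠ ⊥) :
    (N.projectivization : Set (Projectivization K V)).ncard ≡ 1 [MOD p] := by
  have hinj := N.subtype_injective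
  have hrange : (N.projectivization : Set (Projectivization K V))
      = Set.range (Projectivization.map N.subtype hinj) := by
    ext x
    constructor
    · induction x using Projectivization.ind with
      | h v hv =>
        intro hx
        have hvN : v ∈ N := (Submodule.mk_mem_projectivization_iff N hv).1 hx
        exact ⟨Projectivization.mk K ⟨v, hvN⟩ (fun h => hv (congrArg Subtype.val h)), rfl⟩
    · rintro ⟨y, rfl⟩
      induction y using Projectivization.ind with
      | h v hv =>
        rw [Projectivization.map_mk]
        exact (Submodule.mk_mem_projectivization_iff N _).2 v.2
  have hpos : finrank K N ≠ 0 := by rwa [Ne, Submodule.finrank_eq_zero]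
  obtain ⟨m, hm⟩ := Nat.exists_eq_succ_of_ne_zero hpos
  rw [hrange, ← Nat.card_coe_set_eq,
    Nat.card_range_of_injective (Projectivization.map_injective _ hinj),
    Projectivization.card_of_finrank K N hm, Finset.sum_range_succ']
  -- The count is `1 + q + ... + q ^ m`; every term but the first is divisible by `p`.
  have : p ∣ ∑ i ∈ Finset.range m, Nat.card K ^ (i + 1) :=
    Finset.dvd_sum fun i _ => dvd_pow hp i.succ_ne_zero
  simpa using ((Nat.modEq_zero_iff_dvd.2 this).add_right 1)

-- The flat spanned by `x` and `N` is too large to miss any block, so it meets each in a nonempty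
-- projective space, with 1 mod `p` points.
open Module in
theorem projDesign_residualLinearlyEmbeddable {K : Type*} [Field K] [Finite K] {p : ℕ}
    (hp : p.Prime) (hpK : p ∣ Nat.card K) {n d : ℕ} (B : ProjFlat K n d) :
    (projDesign K n d).ResidualLinearlyEmbeddable B p := by
  have hblock : ∀ U : ProjFlat K n d, ∀ M : Submodule K (Fin (n + 1) → K),
      (projDesign K n d).block U ∩ (M.projectivization : Set _)
        = ((Projectivization.Subspace.submodule U.1 ⊓ M).projectivization : Set _) := by
    intro U M
    change (U.1 : Set (Projectivization K (Fin (n + 1) → K))) ∩ _ = _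
    ext x
    induction x using Projectivization.ind with
    | h v hv =>
      simp only [Set.mem_inter_iff, SetLike.mem_coe, Submodule.mk_mem_projectivization_iff,
        Submodule.mem_inf, Projectivization.Subspace.mem_submodule_iff _ hv]
  obtain ⟨N, hN⟩ := Submodule.exists_isCompl (Projectivization.Subspace.submodule B.1)
  have hNdim := Submodule.finrank_add_eq_of_isCompl hN
  rw [B.2, finrank_fin_fun] at hNdim
  have key : ∀ x ∈ (projDesign K n d).block B, ∃ S : Set (Projectivization K (Fin (n + 1) → K)),
      (projDesign K n d).block B ∩ S = {x} ∧
        ∀ j, ((projDesign K n d).block j ∩ S).ncard ≡ 1 [MOD p] := by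
    intro x hx
    have hxB : x.submodule ≤ Projectivization.Subspace.submodule B.1 := by
      rw [← Submodule.mem_projectivization_iff_submodule_le, OrderIso.symm_apply_apply]
      exact hx
    refine ⟨((x.submodule ⊔ N).projectivization : Set _), ?_, fun U => ?_⟩
    · rw [hblock, inf_comm, sup_inf_assoc_of_le _ hxB, hN.symm.inf_eq_bot, sup_bot_eq]
      ext y
      rw [SetLike.mem_coe, Submodule.mem_projectivization_iff_submodule_le, Set.mem_singleton_iff]
      constructor
      · intro hy
        refine Projectivization.submodule_injective (Submodule.eq_of_le_of_finrank_eq hy ?_)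
        rw [Projectivization.finrank_submodule, Projectivization.finrank_submodule]
      · rintro rfl
        exact le_rfl
    · rw [hblock]
      -- A trivial intersection would force dimension `(d + 1) + (n - d + 1) = n + 2` inside `K ^ (n
      -- + 1)`.
      refine Submodule.ncard_projectivization_modEq_one hpK _ fun hbot => ?_
      have hdim : finrank K (x.submodule ⊔ N : Submodule K (Fin (n + 1) → K))
          = 1 + finrank K N := by
        have := Submodule.finrank_sup_add_finrank_inf_eq x.submodule N
        rwa [(hN.disjoint.mono_left hxB).eq_bot, finrank_bot, add_zero,
          Projectivization.finrank_submodule] at this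
      have h1 := Submodule.finrank_sup_add_finrank_inf_eq
        (Projectivization.Subspace.submodule U.1) (x.submodule ⊔ N)
      have h2 := Submodule.finrank_le
        (Projectivization.Subspace.submodule U.1 ⊔ (x.submodule ⊔ N))
      rw [hbot, finrank_bot, U.2, hdim] at h1
      rw [finrank_fin_fun] at h2
      omega
  refine Design.residualLinearlyEmbeddable_of_inter_modEq _ B p hp ?_ fun x hx y hy => ?_
  · have hne : Projectivization.Subspace.submodule B.1 ≠ ⊥ := by
      rw [Ne, ← Submodule.finrank_eq_zero, B.2]
      omega
    obtain ⟨v, hvB, hv⟩ := Submodule.exists_mem_ne_zero_of_ne_bot hne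
    exact ⟨Projectivization.mk K v hv, hvB hv⟩
  · obtain ⟨S, hS, hS'⟩ := key x hx
    obtain ⟨T, hT, hT'⟩ := key y hy
    exact ⟨S, T, hS, hT, fun j => (hS' j).trans (hT' j).symm⟩

/-- A nonempty affine subspace has as many points as its direction. -/
theorem AffineSubspace.ncard_eq_card_direction {K V P : Type*} [Ring K] [AddCommGroup V]
    [Module K V] [AddTorsor V P] (F : AffineSubspace K P) (hF : (F : Set P).Nonempty) :
    (F : Set P).ncard = Nat.card F.direction := by
  obtain ⟨x, hx⟩ := hF
  change _ = Nat.card (F.direction : Set V)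
  rw [AffineSubspace.coe_direction_eq_vsub_set_right hx, Nat.card_coe_set_eq,
    Set.ncard_image_of_injective _ (vsub_left_injective x)]

-- The cutting sets are translates of `N`. Whether a block meets them in 1 or 0 points mod `p`
-- depends only on its direction, not on the translate.
open Module in
theorem affDesign_residualLinearlyEmbeddable {K : Type*} [Field K] [Finite K] {p : ℕ}
    (hp : p.Prime) (hpK : p ∣ Nat.card K) {n d : ℕ} (B : AffFlat K n d) :
    (affDesign K n d).ResidualLinearlyEmbeddable B p := by
  obtain ⟨N, hN⟩ := Submodule.exists_isCompl B.1.direction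
  have hNdim := Submodule.finrank_add_eq_of_isCompl hN
  rw [B.2.2, finrank_fin_fun] at hNdim
  have hcut : ∀ z ∈ B.1, (affDesign K n d).block B ∩ AffineSubspace.mk' z N = {z} := by
    intro z hz
    obtain ⟨w, hw⟩ := AffineSubspace.inter_eq_singleton_of_nonempty_of_isCompl B.2.1
      (AffineSubspace.mk'_nonempty z N) (by rwa [AffineSubspace.direction_mk'])
    have hzw : z ∈ ({w} : Set (Fin n → K)) := hw ▸ ⟨hz, AffineSubspace.self_mem_mk' z N⟩
    exact hw.trans (congrArg _ (Set.mem_singleton_iff.1 hzw).symm)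
  refine Design.residualLinearlyEmbeddable_of_inter_modEq _ B p hp B.2.1 fun x hx y hy =>
    ⟨AffineSubspace.mk' x N, AffineSubspace.mk' y N, hcut x hx, hcut y hy, fun F => ?_⟩
  · change ((F.1 : Set (Fin n → K)) ∩ _).ncard ≡ ((F.1 : Set (Fin n → K)) ∩ _).ncard [MOD p]
    by_cases hdisj : F.1.direction ⊓ N = ⊥
    · have hcompl : IsCompl F.1.direction N := by
        refine ⟨disjoint_iff.2 hdisj, codisjoint_iff.2 (Submodule.eq_top_of_finrank_eq ?_)⟩
        have := Submodule.finrank_sup_add_finrank_inf_eq F.1.direction N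
        rw [hdisj, finrank_bot, F.2.2] at this
        rw [finrank_fin_fun]
        omega
      have hone : ∀ z : Fin n → K, ((F.1 : Set (Fin n → K)) ∩ (AffineSubspace.mk' z N : Set _)).ncard = 1 := by
        intro z
        obtain ⟨w, hw⟩ := AffineSubspace.inter_eq_singleton_of_nonempty_of_isCompl F.2.1
          (AffineSubspace.mk'_nonempty z N) (by rwa [AffineSubspace.direction_mk'])
        rw [hw, Set.ncard_singleton]
      rw [hone, hone]
    · have hzero : ∀ z : Fin n → K, ((F.1 : Set (Fin n → K)) ∩ (AffineSubspace.mk' z N : Set _)).ncard ≡ 0 [MOD p] := by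
        intro z
        rcases Set.eq_empty_or_nonempty ((F.1 : Set (Fin n → K)) ∩ (AffineSubspace.mk' z N : Set _))
          with he | ⟨w, hw⟩
        · rw [he, Set.ncard_empty]
        -- A nonempty intersection is a coset of `F.1.direction ⊓ N`, which is nonzero, so its size
        -- is a positive power of `q`.
        · have hdir : (F.1 ⊓ AffineSubspace.mk' z N).direction = F.1.direction ⊓ N := by
            rw [AffineSubspace.direction_inf_of_mem hw.1 hw.2, AffineSubspace.direction_mk']
          have := AffineSubspace.ncard_eq_card_direction (F.1 ⊓ AffineSubspace.mk' z N) ⟨w, hw⟩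
          change ((F.1 : Set (Fin n → K)) ∩ (AffineSubspace.mk' z N : Set _)).ncard = _ at this
          rw [hdir, Module.natCard_eq_pow_finrank (K := K)] at this
          rw [this]
          refine Nat.modEq_zero_iff_dvd.2 (dvd_pow hpK ?_)
          rwa [Ne, Submodule.finrank_eq_zero]
      exact (hzero x).trans (hzero y).symm

theorem theorem4 (p t : ℕ) (hp : p.Prime) (ht : 1 ≤ t)
    (K : Type*) [Field K] [Finite K] (hK : Nat.card K = p ^ t)
    (n d : ℕ) (hd : 1 ≤ d) (hdn : d < n) :
    (∀ B : ProjFlat K n d, (projDesign K n d).ResidualLinearlyEmbeddable B p) ∧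
      (∀ B : AffFlat K n d, (affDesign K n d).ResidualLinearlyEmbeddable B p) := by
  have hpK : p ∣ Nat.card K := hK ▸ dvd_pow_self p (Nat.one_le_iff_ne_zero.1 ht)
  exact ⟨projDesign_residualLinearlyEmbeddable hp hpK, affDesign_residualLinearlyEmbeddable hp hpK⟩
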